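/- **Lemma 4.5.** Let $n,m\ge 1$ be integers and $1<p<\infty$. Let $\Omega\subset\mathbb R^n$ be a bounded open set and let $M\subset\Omega$ be a compact orientable $(n-1)$-dimensional $C^1$ manifold with (possibly empty) boundary, embedded in $\mathbb R^n$, such that $\Omega\setminus M$ is connected. Fix an orientation of $M$, given by a continuous unit normal field $\nu$; for $u\in W^{1,p}(\Omega\setminus M;\mathbb R^m)$ let $u^{\oplus}$ and $u^{\ominus}$ be the traces of $u$ on the positive and negative side of $M$ and let $[u]:=u^{\oplus}-u^{\ominus}$ be its jump, which is defined $\mathscr H^{n-1}$-a.e. on $M$. Let $\varphi:M\times\mathbb R^m\to[0,+\infty]$ be a Borel function such that, for $\mathscr H^{n-1}$-a.e. $x\in M$, $\varphi(x,0)=0$ and $y\mapsto\varphi(x,y)$ is lower semicontinuous on $\mathbb R^m$; write $\phi(w)(x):=\varphi(x,w(x))$. Let $L^0(M)^+$ be the set of ($\mathscr H^{n-1}$-equivalence classes of) measurable functions on $M$ with values in $[0,+\infty]$. For $\gamma_k,\gamma\in L^0(M)^+$, say that $\gamma_k$ *$\sigma^p_\varphi$-converges* to $\gamma$ if (a) whenever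 $u_j\rightharpoonup u$ weakly in $W^{1,p}(\Omega\setminus M;\mathbb R^m)$ and $\phi([u_j])\le\gamma_{k_j}$ $\mathscr H^{n-1}$-a.e. on $M$ for every $j$, for some sequence of indices $k_j\to\infty$, then $\phi([u])\le\gamma$ $\mathscr H^{n-1}$-a.e. on $M$; (b) there exist a sequence $u^i\in W^{1,p}(\Omega\setminus M;\mathbb R^m)$ with $\sup_i\phi([u^i])=\gamma$ $\mathscr H^{n-1}$-a.e. on $M$ and, for every $i$, a sequence $(u^i_k)_k$ in $W^{1,p}(\Omega\setminus M;\mathbb R^m)$ converging to $u^i$ weakly in $W^{1,p}(\Omega\setminus M;\mathbb R^m)$ as $k\to\infty$, such that $\phi([u^i_k])\le\gamma_k$ $\mathscr H^{n-1}$-a.e. on $M$ for every $i$ and $k$. Then every sequence $(\gamma_k)$ in $L^0(M)^+$ has a $\sigma^p_\varphi$-convergent subsequence: there are indices $k_1<k_2<\cdots$ and $\gamma\in L^0(M)^+$ such that $(\gamma_{k_j})_j$ $\sigma^p_\varphi$-converges to $\gamma$ as $j\to\infty$. -/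

import Mathlib

open MeasureTheory Filter Topology Set
open scoped ENNReal ContDiff RealInnerProductSpace

noncomputable section

namespace CohesiveCrack

/-- The Euclidean space `ℝ^k`. -/
abbrev Vec (k : ℕ) : Type := EuclideanSpace ℝ (Fin k)

/-! ### The Sobolev space `W^{1,p}(U; ℝ^m)` -/

/-- `G` is the weak (distributional) gradient of `u` on `U`: for every test function
`ψ ∈ C_c^∞(U)` and every direction `v`, `∫_U (∂_v ψ) u dx = - ∫_U ψ (G v) dx`. -/
def IsWeakGradient {n m : ℕ} (U : Set (Vec n)) (u : Vec n → Vec m)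
    (G : Vec n → (Vec n →L[ℝ] Vec m)) : Prop :=
  ∀ ψ : Vec n → ℝ, ContDiff ℝ ∞ ψ → HasCompactSupport ψ → tsupport ψ ⊆ U → ∀ v : Vec n,
    ∫ x in U, (fderiv ℝ ψ x v) • u x = - ∫ x in U, ψ x • G x v

theorem integrable_smul_Lp {n : ℕ} {X : Type*} [NormedAddCommGroup X] [NormedSpace ℝ X]
    {U : Set (Vec n)} {p : ℝ≥0∞} [hp : Fact (1 ≤ p)] (g : Lp X p (volume.restrict U))
    {ψ : Vec n → ℝ} (hψ : Continuous ψ) (hc : HasCompactSupport ψ) :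
    Integrable (fun x => ψ x • g x) (volume.restrict U) :=
  ((Lp.memLp g).locallyIntegrable hp.out).integrable_smul_left_of_hasCompactSupport hψ hc

theorem integrable_smul_apply {n m : ℕ}
    {U : Set (Vec n)} {p : ℝ≥0∞} [Fact (1 ≤ p)]
    (G : Lp (Vec n →L[ℝ] Vec m) p (volume.restrict U))
    {ψ : Vec n → ℝ} (hψ : Continuous ψ) (hc : HasCompactSupport ψ) (v : Vec n) :
    Integrable (fun x => ψ x • G x v) (volume.restrict U) :=
  (ContinuousLinearMap.apply ℝ (Vec m) v).integrable_comp (integrable_smul_Lp G hψ hc)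

theorem continuous_fderiv_apply {n : ℕ} {ψ : Vec n → ℝ} (hψ : ContDiff ℝ ∞ ψ) (v : Vec n) :
    Continuous (fun x => fderiv ℝ ψ x v) :=
  (hψ.continuous_fderiv (by simp)).clm_apply continuous_const

/-- The Sobolev space `W^{1,p}(U; ℝ^m)`: the pairs `(u, ∇u)` with `u ∈ L^p(U; ℝ^m)` and
weak gradient `∇u ∈ L^p(U; 𝕄^{m×n})`. It carries the norm `max (‖u‖_p) (‖∇u‖_p)`, which is
equivalent to the usual Sobolev norm. -/
def Sobolev {n : ℕ} (m : ℕ) (U : Set (Vec n)) (p : ℝ≥0∞) [Fact (1 ≤ p)] :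
    Submodule ℝ (Lp (Vec m) p (volume.restrict U) ×
      Lp (Vec n →L[ℝ] Vec m) p (volume.restrict U)) where
  carrier := {w | IsWeakGradient U w.1 w.2}
  zero_mem' := by
    intro ψ _ _ _ v
    have h1 : ∀ᵐ x ∂(volume.restrict U), (fderiv ℝ ψ x v) •
        ((0 : Lp (Vec m) p (volume.restrict U)) : Vec n → Vec m) x = 0 := by
      filter_upwards [Lp.coeFn_zero (Vec m) p (volume.restrict U)] with x hx
      rw [hx]; simp
    have h2 : ∀ᵐ x ∂(volume.restrict U), ψ x •
        ((0 : Lp (Vec n →L[ℝ] Vec m) p (volume.restrict U)) :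
          Vec n → (Vec n →L[ℝ] Vec m)) x v = 0 := by
      filter_upwards [Lp.coeFn_zero (Vec n →L[ℝ] Vec m) p (volume.restrict U)] with x hx
      rw [hx]; simp
    simp only [Prod.fst_zero, Prod.snd_zero]
    rw [integral_congr_ae h1, integral_congr_ae h2]
    simp
  add_mem' := by
    rintro ⟨a, A⟩ ⟨b, B⟩ ha hb ψ hψ hc hs v
    have hd := continuous_fderiv_apply hψ v
    have hdc : HasCompactSupport (fun x => fderiv ℝ ψ x v) := hc.fderiv_apply (𝕜 := ℝ) v
    have h1 : ∀ᵐ x ∂(volume.restrict U), (fderiv ℝ ψ x v) • (a + b : Lp _ p _) x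
        = (fderiv ℝ ψ x v) • a x + (fderiv ℝ ψ x v) • b x := by
      filter_upwards [Lp.coeFn_add a b] with x hx
      rw [hx, Pi.add_apply, smul_add]
    have h2 : ∀ᵐ x ∂(volume.restrict U), ψ x • (A + B : Lp _ p _) x v
        = ψ x • A x v + ψ x • B x v := by
      filter_upwards [Lp.coeFn_add A B] with x hx
      rw [hx, Pi.add_apply, add_apply, smul_add]
    simp only [Prod.mk_add_mk]
    rw [integral_congr_ae h1, integral_congr_ae h2,
      integral_add (integrable_smul_Lp a hd hdc) (integrable_smul_Lp b hd hdc),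
      integral_add (integrable_smul_apply A hψ.continuous hc v)
        (integrable_smul_apply B hψ.continuous hc v),
      ha ψ hψ hc hs v, hb ψ hψ hc hs v, neg_add]
  smul_mem' := by
    rintro c ⟨a, A⟩ ha ψ hψ hc hs v
    have h1 : ∀ᵐ x ∂(volume.restrict U), (fderiv ℝ ψ x v) • (c • a : Lp _ p _) x
        = c • ((fderiv ℝ ψ x v) • a x) := by
      filter_upwards [Lp.coeFn_smul c a] with x hx
      rw [hx, Pi.smul_apply, smul_comm c]
    have h2 : ∀ᵐ x ∂(volume.restrict U), ψ x • (c • A : Lp _ p _) x v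
        = c • (ψ x • A x v) := by
      filter_upwards [Lp.coeFn_smul c A] with x hx
      rw [hx, Pi.smul_apply, smul_apply, smul_comm c]
    simp only [Prod.smul_mk]
    rw [integral_congr_ae h1, integral_congr_ae h2, integral_smul, integral_smul,
      ha ψ hψ hc hs v, smul_neg]

/-- Weak convergence `u_j ⇀ u` in a normed space: convergence of `f (u_j)` to `f u` for every
continuous linear functional `f`. -/
def WeakTendsto {X : Type*} [NormedAddCommGroup X] [NormedSpace ℝ X]
    (u : ℕ → X) (a : X) : Prop :=
  ∀ f : X →L[ℝ] ℝ, Tendsto (fun j => f (u j)) atTop (𝓝 (f a))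

/-! ### Compact oriented hypersurfaces -/

/-- `M ⊆ ℝ^{d+1}` is an embedded `d`-dimensional `C^1` manifold with (possibly empty) boundary:
near each of its points there is a `C^1` diffeomorphism `Φ` between open subsets of `ℝ^{d+1}` that
maps `M` to the hyperplane `{y_d = 0}` (interior points), or to the half-hyperplane
`{y_d = 0, y_0 ≥ 0}` (points of a neighbourhood of the boundary). -/
def IsC1Hypersurface {d : ℕ} (M : Set (Vec (d + 1))) : Prop :=
  ∀ x ∈ M, ∃ Φ : OpenPartialHomeomorph (Vec (d + 1)) (Vec (d + 1)),
    x ∈ Φ.source ∧ ContDiffOn ℝ 1 Φ Φ.source ∧ ContDiffOn ℝ 1 Φ.symm Φ.target ∧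
    (Φ.IsImage M {y | y (Fin.last d) = 0} ∨
      Φ.IsImage M {y | y (Fin.last d) = 0 ∧ 0 ≤ y 0})

/-- An orientation of the hypersurface `M`: a continuous field `ν` of unit vectors on `M`,
orthogonal to all the tangent directions to `M`. -/
structure IsOrientation {d : ℕ} (M : Set (Vec (d + 1))) (ν : Vec (d + 1) → Vec (d + 1)) :
    Prop where
  continuousOn : ContinuousOn ν M
  norm_eq_one : ∀ x ∈ M, ‖ν x‖ = 1
  orthogonal : ∀ x ∈ M, ∀ v ∈ tangentConeAt ℝ M x, ⟪ν x, v⟫ = 0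

/-! ### Traces and jump -/

/-- The vector `a` is the trace at `x`, from the side to which `e` points, of the function `u`
defined almost everywhere on `U`: the mean value of `|u - a|` over the half ball
`{y ∈ U : |y - x| < r, (y - x) · e > 0}` tends to `0` as `r → 0+`. -/
def HasTraceAt {n m : ℕ} (U : Set (Vec n)) (u : Vec n → Vec m) (e x : Vec n) (a : Vec m) : Prop :=
  Tendsto (fun r : ℝ => ⨍⁻ y in {y | y ∈ U ∧ y ∈ Metric.ball x r ∧ 0 < ⟪y - x, e⟫},
    ‖u y - a‖ₑ ∂volume) (𝓝[>] 0) (𝓝 0)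

open Classical in
/-- The trace of `u` at `x` from the side to which `e` points (`0` where there is none). -/
def traceAt {n m : ℕ} (U : Set (Vec n)) (u : Vec n → Vec m) (e x : Vec n) : Vec m :=
  if h : ∃ a, HasTraceAt U u e x a then h.choose else 0

/-- The jump `[u] = u^⊕ - u^⊖` on `M` of `u ∈ W^{1,p}(Ω ∖ M; ℝ^m)`, where `u^⊕` and `u^⊖` are the
traces of `u` on the positive side of `M` (to which `ν` points) and on the negative side. -/
def jump {d m : ℕ} {Ω M : Set (Vec (d + 1))} {p : ℝ≥0∞} [Fact (1 ≤ p)]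
    (ν : Vec (d + 1) → Vec (d + 1)) (u : Sobolev m (Ω \ M) p) (x : M) : Vec m :=
  traceAt (Ω \ M) u.1.1 (ν x) x - traceAt (Ω \ M) u.1.1 (-ν x) x

/-! ### `L^0(M)^+`, the crack energy density and `σ^p_φ`-convergence -/

/-- The `d`-dimensional Hausdorff measure on a subset `M` of `ℝ^{d+1}`. -/
abbrev surf {d : ℕ} (M : Set (Vec (d + 1))) : Measure M := Measure.hausdorffMeasure (d : ℝ)

/-- `L^0(M)^+`: the measurable functions from `M` to `[0, ∞]`, up to `ℋ^d`-a.e. equality. -/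
abbrev L0Plus {d : ℕ} (M : Set (Vec (d + 1))) : Type := M →ₘ[surf M] ℝ≥0∞

/-- The assumptions on the density `φ : M × ℝ^m → [0, ∞]` of the work done to produce a crack. -/
structure IsCrackDensity {d m : ℕ} (M : Set (Vec (d + 1))) (φ : M × Vec m → ℝ≥0∞) : Prop where
  measurable : Measurable φ
  zero : ∀ᵐ x ∂(surf M), φ (x, 0) = 0
  lsc : ∀ᵐ x ∂(surf M), LowerSemicontinuous fun y => φ (x, y)

/-- The function `φ([u])` on `M`. -/
def crackEnergy {d m : ℕ} {Ω M : Set (Vec (d + 1))} {p : ℝ≥0∞} [Fact (1 ≤ p)]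
    (φ : M × Vec m → ℝ≥0∞) (ν : Vec (d + 1) → Vec (d + 1)) (u : Sobolev m (Ω \ M) p) (x : M) :
    ℝ≥0∞ :=
  φ (x, jump ν u x)

/-- `γ_k` `σ^p_φ`-converges to `γ`. -/
structure SigmaTendsto {d m : ℕ} (Ω M : Set (Vec (d + 1))) (p : ℝ≥0∞) [Fact (1 ≤ p)]
    (ν : Vec (d + 1) → Vec (d + 1)) (φ : M × Vec m → ℝ≥0∞)
    (γ : ℕ → L0Plus M) (γlim : L0Plus M) : Prop where
  upper : ∀ (u : ℕ → Sobolev m (Ω \ M) p) (v : Sobolev m (Ω \ M) p) (k : ℕ → ℕ),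
    WeakTendsto u v → Tendsto k atTop atTop →
    (∀ j, crackEnergy φ ν (u j) ≤ᵐ[surf M] γ (k j)) →
    crackEnergy φ ν v ≤ᵐ[surf M] γlim
  attained : ∃ u : ℕ → Sobolev m (Ω \ M) p,
    (fun x => ⨆ i, crackEnergy φ ν (u i) x) =ᵐ[surf M] γlim ∧
    ∃ w : ℕ → ℕ → Sobolev m (Ω \ M) p,
      (∀ i, WeakTendsto (w i) (u i)) ∧
      ∀ i k, crackEnergy φ ν (w i k) ≤ᵐ[surf M] γ k

end CohesiveCrack

end

noncomputable section

namespace CohesiveCrack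

/-! ### Sequential compactness for Kuratowski convergence -/

/-! Let A_k be the set of u in W^{1,p}(Ω∖M) with φ([u]) ≤ γ_k a.e. After passing to a subsequence,
the A_k have a sequential Kuratowski limit K for weak convergence: K contains every weak limit of
elements taken from the A_k along indices tending to infinity, and each point of K is the weak limit
of a full sequence w_k ∈ A_k. Taking γ to be the essential supremum of φ([u]) over u ∈ K gives the
upper bound; since a countable subfamily of K realises it (`exists_seq_ae_le_iSup`), it also gives
attainment.

Kuratowski compactness needs a countable base, which the weak topology generally lacks. But the dual
of W^{1,p} is separable for 1 < p < ∞, so evaluation on a dense sequence of functionals maps the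
space to ℝ^ℕ and detects weak convergence on bounded sets. `exists_subseq_weak_kuratowski` takes the
limit there, for all truncations of A_k to balls of integer radius at once; 0 ∈ A_k keeps these
nonempty.

Separability comes from (L^p)* = L^q and passes to vector-valued functions, products and subspaces.
The essential supremum needs φ([u]) measurable and the surface measure finite: this is the role of
the trace and hypersurface lemmas. -/

/-- In a second countable space, countably many sequences of sets have a common subsequence
along which the upper and the lower Kuratowski limits coincide. -/
theorem exists_subseq_kuratowski {Y ι : Type*} [TopologicalSpace Y] [SecondCountableTopology Y]
    [Countable ι] (A : ι → ℕ → Set Y) :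
    ∃ s : ℕ → ℕ, StrictMono s ∧ ∀ i y,
      (∀ U ∈ 𝓝 y, ∃ᶠ k in atTop, (A i (s k) ∩ U).Nonempty) →
      ∀ U ∈ 𝓝 y, ∀ᶠ k in atTop, (A i (s k) ∩ U).Nonempty := by
  classical
  let B := TopologicalSpace.countableBasis Y
  have hB := TopologicalSpace.isBasis_countableBasis Y
  have : Countable B := TopologicalSpace.countable_countableBasis Y
  -- Record which basic open sets each set meets. The index set is countable, so the product of
  -- copies of `Bool` is sequentially compact; along the subsequence each answer is eventually
  -- constant.
  let F : ℕ → (ι × B → Bool) := fun k q => decide (A q.1 k ∩ q.2).Nonempty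
  obtain ⟨a, s, hs, ha⟩ := CompactSpace.tendsto_subseq F
  refine ⟨s, hs, fun i y hy U hU => ?_⟩
  obtain ⟨V, hVB, hyV, hVU⟩ := hB.mem_nhds_iff.1 hU
  have hlim := (tendsto_pi_nhds.1 ha) (i, ⟨V, hVB⟩)
  rw [nhds_discrete, tendsto_pure] at hlim
  have hfreq := hy V ((hB.isOpen hVB).mem_nhds hyV)
  obtain ⟨k, hk1, hk2⟩ := (hfreq.and_eventually hlim).exists
  have hat : a (i, ⟨V, hVB⟩) = true := by
    rw [← hk2]; simpa [F] using hk1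
  filter_upwards [hlim] with k hk
  rw [hat] at hk
  have : (A i (s k) ∩ V).Nonempty := by simpa [F] using hk
  exact this.mono (inter_subset_inter_right _ hVU)

/-- A point in the lower Kuratowski limit of a sequence of nonempty sets is the limit of a
sequence of points of these sets. -/
theorem exists_seq_tendsto_of_eventually_inter_nonempty {Y : Type*} [PseudoMetricSpace Y]
    {A : ℕ → Set Y} {y : Y} (hA : ∀ k, (A k).Nonempty)
    (h : ∀ U ∈ 𝓝 y, ∀ᶠ k in atTop, (A k ∩ U).Nonempty) :
    ∃ a : ℕ → Y, (∀ k, a k ∈ A k) ∧ Tendsto a atTop (𝓝 y) := by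
  -- The slack 1/(k+1) replaces a nearest point, since the sets need not be closed.
  have hlt : ∀ k : ℕ, ∃ z ∈ A k, dist y z < Metric.infDist y (A k) + 1 / ((k : ℝ) + 1) := fun k =>
    (Metric.infDist_lt_iff (hA k)).1 (lt_add_of_pos_right _ (by positivity))
  choose a haA ha using hlt
  have h0 : Tendsto (fun k => Metric.infDist y (A k)) atTop (𝓝 0) := by
    rw [Metric.tendsto_nhds]
    intro ε hε
    filter_upwards [h _ (Metric.ball_mem_nhds y hε)] with k ⟨z, hz, hzb⟩
    rw [Real.dist_0_eq_abs, abs_of_nonneg Metric.infDist_nonneg]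
    exact (Metric.infDist_lt_iff (hA k)).2 ⟨z, hz, Metric.mem_ball'.1 hzb⟩
  refine ⟨a, haA, tendsto_iff_dist_tendsto_zero.2 ?_⟩
  refine squeeze_zero (fun _ => dist_nonneg) (fun k => ?_)
    (by simpa only [add_zero] using h0.add tendsto_one_div_add_atTop_nhds_zero_nat)
  rw [dist_comm]; exact (ha k).le

/-! ### Weak convergence in a normed space with separable dual. -/

section Weak

variable {X : Type*} [NormedAddCommGroup X] [NormedSpace ℝ X]

/-- Uniform boundedness applied in the bidual: the functionals act on the dual, which is complete
even if `X` is not. The bound is a natural number so that it can index countably many truncations.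
-/
theorem WeakTendsto.exists_norm_le {u : ℕ → X} {a : X} (h : WeakTendsto u a) :
    ∃ R : ℕ, ∀ j, ‖u j‖ ≤ R := by
  obtain ⟨C, hC⟩ := banach_steinhaus (g := fun j => NormedSpace.inclusionInDoubleDual ℝ X (u j))
    (fun f => by
      obtain ⟨C, hC⟩ := (h f).norm.bddAbove_range
      exact ⟨C, fun j => by simpa using hC (mem_range_self j)⟩)
  obtain ⟨R, hR⟩ := exists_nat_ge C
  refine ⟨R, fun j => ?_⟩
  rw [← (NormedSpace.inclusionInDoubleDualLi ℝ (E := X)).norm_map (u j)]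
  exact (hC j).trans hR

theorem weakTendsto_of_dense {u : ℕ → X} {a : X} {R : ℝ} (hu : ∀ j, ‖u j‖ ≤ R)
    {D : Set (StrongDual ℝ X)} (hD : Dense D)
    (h : ∀ f ∈ D, Tendsto (fun j => f (u j)) atTop (𝓝 (f a))) : WeakTendsto u a := by
  intro f
  have hb : ∀ g : StrongDual ℝ X, ∀ j, dist (f (u j)) (g (u j)) ≤ ‖f - g‖ * R := fun g j => by
    rw [dist_eq_norm, ← sub_apply]
    exact ((f - g).le_opNorm _).trans (by gcongr; exact hu j)
  have hR : 0 ≤ R := (norm_nonneg _).trans (hu 0)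
  rw [Metric.tendsto_nhds]
  intro ε hε
  -- This tolerance makes the errors at `u j` and at `a` each less than ε/3; the +1 keeps the
  -- denominator positive.
  obtain ⟨g, hgD, hg⟩ := hD.exists_dist_lt f
    (show 0 < ε / (3 * (R + ‖a‖ + 1)) by positivity)
  rw [dist_eq_norm, lt_div_iff₀ (by positivity)] at hg
  have hga : dist (g a) (f a) ≤ ‖f - g‖ * ‖a‖ := by
    rw [dist_comm, dist_eq_norm, ← sub_apply]
    exact (f - g).le_opNorm _
  filter_upwards [Metric.tendsto_nhds.1 (h g hgD) (ε / 3) (by positivity)] with j hj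
  have h1 := dist_triangle4 (f (u j)) (g (u j)) (g a) (f a)
  have h2 := hb g j
  nlinarith [norm_nonneg (f - g), norm_nonneg a]

/-- Compactness of sequences of sets for the sequential Kuratowski convergence with respect to
weak convergence, in a normed space with separable dual. -/
theorem exists_subseq_weak_kuratowski [TopologicalSpace.SeparableSpace (StrongDual ℝ X)]
    (A : ℕ → Set X) (hA : ∀ k, (0 : X) ∈ A k) :
    ∃ s : ℕ → ℕ, StrictMono s ∧ ∃ K : Set X,
      (∀ (u : ℕ → X) (v : X) (k : ℕ → ℕ), WeakTendsto u v → Tendsto k atTop atTop →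
        (∀ j, u j ∈ A (s (k j))) → v ∈ K) ∧
      ∀ v ∈ K, ∃ w : ℕ → X, WeakTendsto w v ∧ ∀ k, w k ∈ A (s k) := by
  let f := TopologicalSpace.denseSeq (StrongDual ℝ X)
  have hf : DenseRange f := TopologicalSpace.denseRange_denseSeq _
  let T : X → (ℕ → ℝ) := fun x i => f i x
  -- The truncation is needed because convergence under `T` implies weak convergence only for
  -- bounded sequences.
  let C : ℕ → ℕ → Set X := fun R k => A k ∩ Metric.closedBall 0 R
  obtain ⟨s, hs, hsK⟩ := exists_subseq_kuratowski fun R k => T '' C R k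
  refine ⟨s, hs, {v | ∃ R : ℕ, ∀ U ∈ 𝓝 (T v), ∀ᶠ k in atTop, (T '' C R (s k) ∩ U).Nonempty},
    ?_, ?_⟩
  · intro u v k huv hk huA
    obtain ⟨R, hR⟩ := huv.exists_norm_le
    refine ⟨R, hsK R (T v) fun U hU => ?_⟩
    have hT : Tendsto (fun j => T (u j)) atTop (𝓝 (T v)) :=
      tendsto_pi_nhds.2 fun i => huv (f i)
    refine hk.frequently (Eventually.frequently ?_)
    filter_upwards [hT hU] with j hj
    exact ⟨T (u j), mem_image_of_mem _ ⟨huA j, by simpa using hR j⟩, hj⟩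
  · rintro v ⟨R, hR⟩
    let := TopologicalSpace.metrizableSpaceMetric (ℕ → ℝ)
    obtain ⟨a, haC, ha⟩ := exists_seq_tendsto_of_eventually_inter_nonempty
      (fun k => ⟨T 0, mem_image_of_mem T (⟨hA (s k), by simp⟩ : (0 : X) ∈ C R (s k))⟩) hR
    choose w hw hwa using haC
    refine ⟨w, weakTendsto_of_dense (R := R) (fun j => by simpa using (hw j).2) hf ?_,
      fun k => (hw k).1⟩
    rintro _ ⟨i, rfl⟩
    have := (tendsto_pi_nhds.1 ha) i
    simpa [← hwa, T] using this

end Weak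

/-! ### Essential suprema -/

/-- A nonempty family of measurable functions has a countable subfamily the supremum of which
is an almost everywhere upper bound of the family. -/
theorem exists_seq_ae_le_iSup {α ι : Type*} [MeasurableSpace α] {μ : Measure α}
    [IsFiniteMeasure μ] [Nonempty ι] (F : ι → α → ℝ≥0∞) (hF : ∀ i, AEMeasurable (F i) μ) :
    ∃ c : ℕ → ι, ∀ i, F i ≤ᵐ[μ] fun x => ⨆ n, F (c n) x := by
  -- Since t ↦ 1/(1+t) is injective, decreasing and bounded on [0,∞], `J` is finite even where the
  -- supremum is infinite; a minimiser has the largest supremum.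
  let J : (ℕ → ι) → ℝ≥0∞ := fun c => ∫⁻ x, (1 + ⨆ n, F (c n) x)⁻¹ ∂μ
  have hmono : ∀ c c' : ℕ → ι, range c ⊆ range c' → J c' ≤ J c := fun c c' h => by
    refine lintegral_mono fun x =>
      ENNReal.inv_le_inv.2 (add_le_add_right (iSup_le fun n => ?_) 1)
    obtain ⟨k, hk⟩ := h (mem_range_self n)
    rw [← hk]; exact le_iSup (fun n : ℕ => F (c' n) x) k
  have hunion : ∀ d : ℕ → ℕ → ι, ∃ c : ℕ → ι, ∀ k, range (d k) ⊆ range c := fun d => by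
    obtain ⟨e, he⟩ := exists_surjective_nat (ℕ × ℕ)
    refine ⟨fun n => d (e n).1 (e n).2, fun k => ?_⟩
    rintro _ ⟨n, rfl⟩
    obtain ⟨l, hl⟩ := he (k, n)
    exact ⟨l, by simp [hl]⟩
  obtain ⟨a, -, ha, har⟩ := exists_seq_tendsto_sInf (range_nonempty J) (OrderBot.bddBelow _)
  choose d hd using har
  obtain ⟨c, hc⟩ := hunion d
  have hmin : ∀ c', J c ≤ J c' := fun c' =>
    (ge_of_tendsto' ha fun k => (hmono _ _ (hc k)).trans_eq (hd k)).trans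
      (sInf_le (mem_range_self c'))
  refine ⟨c, fun i => ?_⟩
  -- Adding `i` to the minimiser cannot lower `J`, so the two integrands, hence the two suprema,
  -- agree a.e.
  let c' : ℕ → ι := fun n => n.casesOn i c
  have hsup : ∀ x n, F (c' n) x ≤ ⨆ n, F (c' n) x := fun x => le_iSup (fun n => F (c' n) x)
  have hle : ∀ x, ⨆ n, F (c n) x ≤ ⨆ n, F (c' n) x := fun x => iSup_le fun n => hsup x (n + 1)
  have hmeas : AEMeasurable (fun x => (1 + ⨆ n, F (c n) x)⁻¹) μ :=
    ((AEMeasurable.iSup fun n => hF (c n)).const_add 1).inv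
  have hfin : J c' ≠ ⊤ := by
    refine ne_top_of_le_ne_top (measure_ne_top μ univ) ?_
    refine (lintegral_mono (g := fun _ => 1) fun x => ?_).trans_eq (by simp)
    simp
  have := ae_eq_of_ae_le_of_lintegral_le
    (ae_of_all _ fun x => ENNReal.inv_le_inv.2 (add_le_add_right (hle x) 1)) hfin hmeas (hmin c')
  filter_upwards [this] with x hx
  have hx' := (ENNReal.add_right_inj ENNReal.one_ne_top).1 (inv_injective hx)
  rw [← hx']
  exact hsup x 0

/-! ### The dual of `L^p` on a finite measure space -/

section LpDual

variable {α : Type*} [MeasurableSpace α] {μ : Measure α} [IsFiniteMeasure μ]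
  {p q : ℝ≥0∞} [Fact (1 ≤ p)] [Fact (1 ≤ q)]

/-- The indicator function of a measurable set as an element of `L^p`. -/
abbrev indLp (μ : Measure α) [IsFiniteMeasure μ] (p : ℝ≥0∞) {A : Set α} (hA : MeasurableSet A) :
    Lp ℝ p μ :=
  indicatorConstLp p hA (measure_ne_top μ A) 1

theorem strongDual_Lp_ext (hp : p ≠ ⊤) {L L' : StrongDual ℝ (Lp ℝ p μ)}
    (h : ∀ A (hA : MeasurableSet A), L (indLp μ p hA) = L' (indLp μ p hA)) : L = L' := by
  ext f
  refine Lp.induction hp (motive := fun f => L f = L' f) ?_ ?_ ?_ f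
  · intro c A hA hμA
    have : (Lp.simpleFunc.indicatorConst p hA hμA.ne c : Lp ℝ p μ) = c • indLp μ p hA := by
      rw [Lp.simpleFunc.coe_indicatorConst]
      ext1
      filter_upwards [Lp.coeFn_smul c (indLp μ p hA), indicatorConstLp_coeFn (p := p) (hs := hA)
        (hμs := measure_ne_top μ A) (c := (1 : ℝ)), indicatorConstLp_coeFn (p := p) (hs := hA)
        (hμs := hμA.ne) (c := c)] with x h1 h2 h3
      rw [h1, h3, Pi.smul_apply, h2]
      by_cases h : x ∈ A <;> simp [h]
    rw [this, map_smul, map_smul, h]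
  · intro f g hf hg _ h1 h2
    rw [map_add, map_add, h1, h2]
  · exact isClosed_eq L.continuous L'.continuous

open Classical in
/-- The signed measure `A ↦ L 1_A` associated with a functional `L` on `L^p`. -/
def dualSignedMeasure (hp : p ≠ ⊤) (L : StrongDual ℝ (Lp ℝ p μ)) : SignedMeasure α where
  measureOf' A := if hA : MeasurableSet A then L (indLp μ p hA) else 0
  empty' := by simp [indLp]
  not_measurable' A hA := by simp [hA]
  m_iUnion' A hA hd := by
    have hfin : ∀ t : Finset ℕ, MeasurableSet (⋃ i ∈ t, A i) :=
      fun t => Finset.measurableSet_biUnion t fun i _ => hA i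
    have hsum : ∀ t : Finset ℕ, ∑ i ∈ t, indLp μ p (hA i) = indLp μ p (hfin t) := fun t => by
      induction t using Finset.induction_on with
      | empty => simp [indLp]
      | insert a t hat ih =>
        have hdis : Disjoint (A a) (⋃ i ∈ t, A i) :=
          disjoint_iUnion₂_right.2 fun i hi => hd (by rintro rfl; exact hat hi)
        rw [Finset.sum_insert hat, ih, indLp, indLp,
          ← indicatorConstLp_disjoint_union _ _ _ _ hdis]
        congr 1
        simp
    simp only [hA, MeasurableSet.iUnion hA, dif_pos]
    refine HasSum.mapL L ?_
    rw [HasSum]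
    simp only [hsum]
    -- Countable additivity: the measure of the tail tends to 0, and for p < ∞ this gives L^p
    -- convergence of the indicators.
    refine tendsto_indicatorConstLp_set hp ?_
    have hsub : ∀ t : Finset ℕ, (⋃ i ∈ t, A i) ⊆ ⋃ i, A i :=
      fun t => iUnion₂_subset fun i _ => subset_iUnion A i
    have hdiff : ∀ t : Finset ℕ, μ (symmDiff (⋃ i ∈ t, A i) (⋃ i, A i))
        = μ (⋃ i, A i) - ∑ i ∈ t, μ (A i) := fun t => by
      rw [Set.symmDiff_def, sdiff_eq_empty.2 (hsub t), empty_union,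
        measure_sdiff (hsub t) (hfin t).nullMeasurableSet (measure_ne_top _ _),
        measure_biUnion_finset (fun i _ j _ hij => hd hij) fun i _ => hA i]
    simp only [hdiff]
    have hs : HasSum (fun i => μ (A i)) (μ (⋃ i, A i)) := by
      rw [measure_iUnion hd hA]; exact ENNReal.summable.hasSum
    have := ENNReal.Tendsto.sub (tendsto_const_nhds (x := μ (⋃ i, A i))) hs
      (Or.inl (measure_ne_top _ _))
    rwa [tsub_self] at this

theorem dualSignedMeasure_apply (hp : p ≠ ⊤) (L : StrongDual ℝ (Lp ℝ p μ)) {A : Set α}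
    (hA : MeasurableSet A) : dualSignedMeasure hp L A = L (indLp μ p hA) :=
  dif_pos hA

/-- Radon–Nikodym: null sets have zero indicator in L^p, so the signed measure of `L` is absolutely
continuous. At this stage the density is only known to be in L^1. -/
theorem exists_density_of_strongDual_Lp (hp : p ≠ ⊤) (L : StrongDual ℝ (Lp ℝ p μ)) :
    ∃ g : α → ℝ, Measurable g ∧ Integrable g μ ∧
      ∀ A (hA : MeasurableSet A), L (indLp μ p hA) = ∫ x in A, g x ∂μ := by
  have hac : dualSignedMeasure hp L ≪ᵥ μ.toENNRealVectorMeasure := by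
    refine VectorMeasure.AbsolutelyContinuous.mk fun A hA h0 => ?_
    rw [Measure.toENNRealVectorMeasure_apply_measurable hA] at h0
    rw [dualSignedMeasure_apply hp L hA]
    have : indLp μ p hA = 0 := by
      rw [Lp.eq_zero_iff_ae_eq_zero]
      refine indicatorConstLp_coeFn.trans ?_
      exact indicator_meas_zero h0
    rw [this, map_zero]
  refine ⟨(dualSignedMeasure hp L).rnDeriv μ, SignedMeasure.measurable_rnDeriv _ _,
    SignedMeasure.integrable_rnDeriv _ _, fun A hA => ?_⟩
  rw [← dualSignedMeasure_apply hp L hA,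
    ← withDensityᵥ_apply (SignedMeasure.integrable_rnDeriv _ _) hA,
    SignedMeasure.withDensityᵥ_rnDeriv_eq _ _ hac]

variable [ENNReal.HolderConjugate q p]

/-- The pairing of `L^q` with `L^p`. -/
abbrev dualPairing (μ : Measure α) (q p : ℝ≥0∞) [Fact (1 ≤ p)] [Fact (1 ≤ q)]
    [ENNReal.HolderConjugate q p] : Lp ℝ q μ →L[ℝ] StrongDual ℝ (Lp ℝ p μ) :=
  (ContinuousLinearMap.mul ℝ ℝ).lpPairing μ q p

theorem dualPairing_indLp (g : Lp ℝ q μ) {A : Set α} (hA : MeasurableSet A) :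
    dualPairing μ q p g (indLp μ p hA) = ∫ x in A, g x ∂μ := by
  rw [ContinuousLinearMap.lpPairing_eq_integral, ← integral_indicator hA]
  refine integral_congr_ae ?_
  filter_upwards [indicatorConstLp_coeFn (p := p) (hs := hA) (hμs := measure_ne_top μ A)
    (c := (1 : ℝ))] with x hx
  rw [hx]
  by_cases h : x ∈ A <;> simp [h]

/-- If the restriction of a functional `L` to the functions supported in `B` has a density in
`L^q`, then the norm of the density in `L^q` is at most `‖L‖`. -/
theorem eLpNorm_density_le (hp : p ≠ ⊤) (hq : q ≠ ⊤) (L : StrongDual ℝ (Lp ℝ p μ)) {g : α → ℝ}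
    (hgm : Measurable g) (hL : ∀ A (hA : MeasurableSet A), L (indLp μ p hA) = ∫ x in A, g x ∂μ)
    {B : Set α} (hB : MeasurableSet B) {C : ℝ} (hC : ∀ x ∈ B, |g x| ≤ C) :
    eLpNorm (B.indicator g) q μ ≤ ENNReal.ofReal ‖L‖ := by
  have hpq : q.toReal.HolderConjugate p.toReal := ENNReal.HolderConjugate.toReal_of_ne_top hq hp
  let G := B.indicator g
  have hGm : Measurable G := hgm.indicator hB
  have hGC : ∀ x, |G x| ≤ max C 0 := fun x => by
    by_cases hx : x ∈ B
    · simpa [G, hx] using Or.inl (hC x hx)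
    · simp [G, hx]
  have hGq : MemLp G q μ := MemLp.of_bound hGm.aestronglyMeasurable (max C 0) (ae_of_all _ hGC)
  -- The equality case of Hölder: F = G|G|^(q-2) satisfies GF = |F|^p = |G|^q.
  let F : α → ℝ := fun x => G x * |G x| ^ (q.toReal - 2)
  have hFm : Measurable F := hGm.mul (hGm.abs.pow_const _)
  have hFabs : ∀ x, |F x| = |G x| ^ (q.toReal - 1) := fun x => by
    rcases eq_or_ne (G x) 0 with h | h
    · simp [F, h, Real.zero_rpow hpq.sub_one_pos.ne']
    · rw [abs_mul, abs_of_nonneg (Real.rpow_nonneg (abs_nonneg _) _),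
        ← Real.rpow_one_add' (abs_nonneg _) (by linarith [hpq.lt])]
      congr 1; ring
  have hFp : MemLp F p μ := by
    refine MemLp.of_bound hFm.aestronglyMeasurable ((max C 0) ^ (q.toReal - 1))
      (ae_of_all _ fun x => ?_)
    rw [Real.norm_eq_abs, hFabs]
    exact Real.rpow_le_rpow (abs_nonneg _) (hGC x) hpq.sub_one_pos.le
  have hFG : ∀ x, G x * F x = |G x| ^ q.toReal := fun x => by
    rcases eq_or_ne (G x) 0 with h | h
    · simp [h, Real.zero_rpow hpq.ne_zero]
    · rw [← mul_assoc, ← abs_mul_abs_self, mul_assoc,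
        ← Real.rpow_one_add' (abs_nonneg _) (by linarith [hpq.lt]),
        ← Real.rpow_one_add' (abs_nonneg _) (by linarith [hpq.lt])]
      congr 1; ring
  have hFpow : ∀ x, ‖F x‖ ^ p.toReal = |G x| ^ q.toReal := fun x => by
    rw [Real.norm_eq_abs, hFabs, ← Real.rpow_mul (abs_nonneg _), hpq.sub_one_mul_conj]
  -- Multiplication by the indicator of `B`. The functional `L ∘ R` has the bounded density `G`, so
  -- it is a genuine pairing and can be evaluated on `F`.
  let R : Lp ℝ p μ →L[ℝ] Lp ℝ p μ :=
    (ContinuousLinearMap.mul ℝ ℝ).holderL μ ⊤ p p (indLp μ ⊤ hB)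
  have hR : ∀ f : Lp ℝ p μ, R f =ᵐ[μ] B.indicator f := fun f => by
    filter_upwards [(ContinuousLinearMap.mul ℝ ℝ).coeFn_holder (r := p) (indLp μ ⊤ hB) f,
      indicatorConstLp_coeFn (p := ⊤) (hs := hB) (hμs := measure_ne_top μ B)
      (c := (1 : ℝ))] with x hx hx'
    refine hx.trans ?_
    rw [hx']
    by_cases h : x ∈ B <;> simp [h]
  have hpair : L.comp R = dualPairing μ q p (hGq.toLp G) := by
    refine strongDual_Lp_ext hp fun A hA => ?_
    have : R (indLp μ p hA) = indLp μ p (hA.inter hB) := by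
      ext1
      filter_upwards [hR (indLp μ p hA), indicatorConstLp_coeFn (p := p) (hs := hA)
        (hμs := measure_ne_top μ A) (c := (1 : ℝ)), indicatorConstLp_coeFn (p := p)
        (hs := hA.inter hB) (hμs := measure_ne_top μ (A ∩ B)) (c := (1 : ℝ))] with x h1 h2 h3
      rw [h1, h3, inter_comm, ← indicator_indicator]
      by_cases h : x ∈ B <;> simp [h, h2]
    rw [ContinuousLinearMap.comp_apply, this, hL, dualPairing_indLp,
      setIntegral_congr_ae (g := G) hA (hGq.coeFn_toLp.mono fun x hx _ => hx),
      setIntegral_indicator hB]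
  have ha : 0 ≤ ∫ x, |G x| ^ q.toReal ∂μ := integral_nonneg fun x => by positivity
  set a := ∫ x, |G x| ^ q.toReal ∂μ
  have h1 : L (hFp.toLp F) = a := by
    have hRF : R (hFp.toLp F) = hFp.toLp F := by
      ext1
      filter_upwards [hR (hFp.toLp F), hFp.coeFn_toLp] with x hx hx'
      rw [hx]
      by_cases h : x ∈ B
      · simp [h]
      · simp [h, hx', F, G]
    rw [← hRF, ← ContinuousLinearMap.comp_apply, hpair, ContinuousLinearMap.lpPairing_eq_integral]
    refine integral_congr_ae ?_
    filter_upwards [hGq.coeFn_toLp, hFp.coeFn_toLp] with x hx hx'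
    rw [hx, hx', ContinuousLinearMap.mul_apply', hFG]
  have h2 : ‖hFp.toLp F‖ = a ^ p.toReal⁻¹ := by
    rw [Lp.norm_toLp, hFp.eLpNorm_eq_integral_rpow_norm (one_pos.trans_le Fact.out).ne' hp,
      ENNReal.toReal_ofReal (by positivity)]
    simp only [hFpow, a]
  have h3 : eLpNorm G q μ = ENNReal.ofReal (a ^ q.toReal⁻¹) :=
    hGq.eLpNorm_eq_integral_rpow_norm (one_pos.trans_le Fact.out).ne' hq
  change eLpNorm G q μ ≤ _
  rw [h3]
  refine ENNReal.ofReal_le_ofReal ?_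
  -- Testing on `F` gives a ≤ ‖L‖ a^(1/p); dividing by a^(1/p) requires a > 0.
  rcases ha.eq_or_lt with h0 | h0
  · rw [← h0, Real.zero_rpow (inv_ne_zero hpq.ne_zero)]
    exact norm_nonneg _
  · have hle : a ≤ ‖L‖ * a ^ p.toReal⁻¹ := by
      have := (le_abs_self _).trans (L.le_opNorm (hFp.toLp F))
      rwa [h1, h2] at this
    have hsplit : a = a ^ q.toReal⁻¹ * a ^ p.toReal⁻¹ := by
      rw [← Real.rpow_add h0, hpq.inv_add_inv_eq_one, Real.rpow_one]
    have hpos : 0 < a ^ p.toReal⁻¹ := by positivity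
    nth_rewrite 1 [hsplit] at hle
    exact le_of_mul_le_mul_right hle hpos

/-- The Riesz representation theorem for `L^p` on a finite measure space. -/
theorem dualPairing_surjective (hp : p ≠ ⊤) (hq : q ≠ ⊤) :
    Function.Surjective (dualPairing μ q p) := by
  intro L
  obtain ⟨g, hgm, -, hg⟩ := exists_density_of_strongDual_Lp hp L
  -- Truncating where |g| ≤ n gives L^q bounds by ‖L‖ uniform in n; Fatou transfers the bound to
  -- `g`.
  let B : ℕ → Set α := fun n => {x | |g x| ≤ n}
  have hB : ∀ n, MeasurableSet (B n) := fun n => measurableSet_le hgm.abs measurable_const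
  have hlim : ∀ x, Tendsto (fun n => (B n).indicator g x) atTop (𝓝 (g x)) := fun x => by
    obtain ⟨N, hN⟩ := exists_nat_ge |g x|
    refine tendsto_const_nhds.congr' ?_
    filter_upwards [eventually_ge_atTop N] with n hn
    rw [indicator_of_mem]
    exact hN.trans (by exact_mod_cast hn)
  have hgq : MemLp g q μ := by
    refine ⟨hgm.aestronglyMeasurable, lt_of_le_of_lt ?_ (ENNReal.ofReal_lt_top (r := ‖L‖))⟩
    refine (Lp.eLpNorm_lim_le_liminf_eLpNorm
      (fun n => (hgm.indicator (hB n)).aestronglyMeasurable) g (ae_of_all _ hlim)).trans ?_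
    refine (liminf_le_liminf (Eventually.of_forall fun n =>
      eLpNorm_density_le hp hq L hgm hg (hB n) fun x hx => hx)).trans_eq ?_
    simp
  refine ⟨hgq.toLp g, strongDual_Lp_ext hp fun A hA => ?_⟩
  rw [dualPairing_indLp, hg]
  exact setIntegral_congr_ae hA (hgq.coeFn_toLp.mono fun x hx _ => hx)

/-- The condition p > 1 makes the conjugate exponent q finite, so L^q is separable, and the dual is
its continuous image. -/
theorem separableSpace_strongDual_Lp [IsSeparable μ] (hp1 : 1 < p) (hp : p ≠ ⊤) :
    TopologicalSpace.SeparableSpace (StrongDual ℝ (Lp ℝ p μ)) := by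
  have hq : ENNReal.conjExponent p ≠ ⊤ := by
    simpa [ENNReal.conjExponent, tsub_eq_zero_iff_le] using hp1
  have : Fact (ENNReal.conjExponent p ≠ ⊤) := ⟨hq⟩
  have : Fact (1 ≤ ENNReal.conjExponent p) := ⟨le_self_add⟩
  exact (dualPairing_surjective (μ := μ) (q := ENNReal.conjExponent p) hp hq).denseRange
    |>.separableSpace (dualPairing μ _ p).continuous

end LpDual

/-! ### Separability of the dual of the Sobolev space -/

/-- Splitting a function into its coordinates in a basis writes every functional as a finite sum of
scalar ones. -/
theorem separableSpace_strongDual_Lp_of_finiteDimensional {α E : Type*} [MeasurableSpace α]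
    {μ : Measure α} [IsFiniteMeasure μ] [IsSeparable μ] [NormedAddCommGroup E] [NormedSpace ℝ E]
    [FiniteDimensional ℝ E] {p : ℝ≥0∞} [Fact (1 ≤ p)] (hp1 : 1 < p) (hp : p ≠ ⊤) :
    TopologicalSpace.SeparableSpace (StrongDual ℝ (Lp E p μ)) := by
  have := separableSpace_strongDual_Lp (μ := μ) hp1 hp
  let b := Module.finBasis ℝ E
  let c : Fin (Module.finrank ℝ E) → E →L[ℝ] ℝ := fun i => (b.coord i).toContinuousLinearMap
  let e : Fin (Module.finrank ℝ E) → ℝ →L[ℝ] E := fun i =>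
    ContinuousLinearMap.toSpanSingleton ℝ (b i)
  let Ψ : (Fin (Module.finrank ℝ E) → StrongDual ℝ (Lp ℝ p μ)) → StrongDual ℝ (Lp E p μ) :=
    fun L => ∑ i, (L i).comp ((c i).compLpL p μ)
  have hΨ : Continuous Ψ := by fun_prop
  have hsurj : Function.Surjective Ψ := fun L => by
    refine ⟨fun i => L.comp ((e i).compLpL p μ), ?_⟩
    ext f
    have hf : ∑ i, (e i).compLpL p μ ((c i).compLpL p μ f) = f := by
      ext1
      have h1 : ∀ i, (e i).compLpL p μ ((c i).compLpL p μ f) =ᵐ[μ] fun x => c i (f x) • b i :=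
        fun i => by
          filter_upwards [(e i).coeFn_compLpL ((c i).compLpL p μ f), (c i).coeFn_compLpL f]
            with x hx hx'
          rw [hx, hx']; simp [e]
      filter_upwards [Lp.coeFn_fun_finsetSum Finset.univ
        fun i => (e i).compLpL p μ ((c i).compLpL p μ f), ae_all_iff.2 h1] with x hx hx'
      rw [hx]
      simp only [hx']
      exact b.sum_repr (f x)
    conv_rhs => rw [← hf]
    simp [Ψ, sum_apply]
  exact hsurj.denseRange.separableSpace hΨ

theorem separableSpace_strongDual_prod {X Y : Type*} [NormedAddCommGroup X] [NormedSpace ℝ X]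
    [NormedAddCommGroup Y] [NormedSpace ℝ Y] [TopologicalSpace.SeparableSpace (StrongDual ℝ X)]
    [TopologicalSpace.SeparableSpace (StrongDual ℝ Y)] :
    TopologicalSpace.SeparableSpace (StrongDual ℝ (X × Y)) := by
  let Ψ : StrongDual ℝ X × StrongDual ℝ Y → StrongDual ℝ (X × Y) := fun L =>
    L.1.comp (ContinuousLinearMap.fst ℝ X Y) + L.2.comp (ContinuousLinearMap.snd ℝ X Y)
  have hΨ : Continuous Ψ := by fun_prop
  have hsurj : Function.Surjective Ψ := fun L => by
    refine ⟨(L.comp (ContinuousLinearMap.inl ℝ X Y), L.comp (ContinuousLinearMap.inr ℝ X Y)), ?_⟩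
    exact ContinuousLinearMap.ext fun x => by simp [Ψ, ← map_add]
  exact hsurj.denseRange.separableSpace hΨ

/-- By Hahn–Banach, restriction of functionals to `S` is surjective. -/
theorem separableSpace_strongDual_submodule {X : Type*} [NormedAddCommGroup X] [NormedSpace ℝ X]
    [TopologicalSpace.SeparableSpace (StrongDual ℝ X)] (S : Submodule ℝ X) :
    TopologicalSpace.SeparableSpace (StrongDual ℝ S) := by
  let Ψ : StrongDual ℝ X → StrongDual ℝ S := fun L => L.comp S.subtypeL
  have hΨ : Continuous Ψ := by fun_prop
  have hsurj : Function.Surjective Ψ := fun L => by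
    obtain ⟨g, hg, -⟩ := exists_extension_norm_eq S L
    exact ⟨g, ContinuousLinearMap.ext hg⟩
  exact hsurj.denseRange.separableSpace hΨ

theorem separableSpace_strongDual_Sobolev {n m : ℕ} {U : Set (Vec n)} {p : ℝ≥0∞} [Fact (1 ≤ p)]
    (hp1 : 1 < p) (hp : p ≠ ⊤) (hU : volume U ≠ ⊤) :
    TopologicalSpace.SeparableSpace (StrongDual ℝ (Sobolev m U p)) := by
  have : IsFiniteMeasure (volume.restrict U) := ⟨by simpa using hU.lt_top⟩
  have := separableSpace_strongDual_Lp_of_finiteDimensional (μ := volume.restrict U)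
    (E := Vec m) hp1 hp
  have := separableSpace_strongDual_Lp_of_finiteDimensional (μ := volume.restrict U)
    (E := Vec n →L[ℝ] Vec m) hp1 hp
  have := separableSpace_strongDual_prod (X := Lp (Vec m) p (volume.restrict U))
    (Y := Lp (Vec n →L[ℝ] Vec m) p (volume.restrict U))
  exact separableSpace_strongDual_submodule _

/-! ### The surface measure of a compact hypersurface -/

/-- The set lies in a Lipschitz image of a closed ball of ℝ^d with the sup metric, where μH[d] is
Lebesgue measure. -/
theorem hausdorffMeasure_hyperplane_inter_lt_top {d : ℕ} (c : Vec (d + 1)) (r : ℝ) :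
    μH[(d : ℝ)] ({y : Vec (d + 1) | y (Fin.last d) = 0} ∩ Metric.ball c r) < ⊤ := by
  let ι : (Fin d → ℝ) →ₗ[ℝ] Vec (d + 1) :=
    { toFun := fun z => WithLp.toLp 2 (Fin.snoc (α := fun _ => ℝ) z 0)
      map_add' := fun z w => by
        ext i; refine Fin.lastCases ?_ (fun j => ?_) i <;> simp
      map_smul' := fun a z => by
        ext i; refine Fin.lastCases ?_ (fun j => ?_) i <;> simp }
  have hL := ι.toContinuousLinearMap.lipschitz
  let B : Set (Fin d → ℝ) := Metric.closedBall (fun i => c i.castSucc) |r|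
  have hB : μH[(d : ℝ)] B < ⊤ := by
    have := hausdorffMeasure_pi_real (ι := Fin d)
    rw [Fintype.card_fin] at this
    rw [this]
    exact measure_closedBall_lt_top
  have hsub : {y : Vec (d + 1) | y (Fin.last d) = 0} ∩ Metric.ball c r ⊆
      ι.toContinuousLinearMap '' B := by
    rintro y ⟨hy0, hy⟩
    refine ⟨fun i => y i.castSucc, ?_, ?_⟩
    · refine (dist_pi_le_iff (abs_nonneg r)).2 fun i => ?_
      have h1 : dist (y i.castSucc) (c i.castSucc) ≤ dist y c := by
        simpa [dist_eq_norm] using PiLp.norm_apply_le (y - c) i.castSucc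
      exact h1.trans ((Metric.mem_ball.1 hy).le.trans (le_abs_self r))
    · ext i
      refine Fin.lastCases ?_ (fun j => ?_) i
      · simpa [ι] using hy0.symm
      · simp [ι]
  refine (measure_mono hsub).trans_lt ((hL.hausdorffMeasure_image_le (by positivity) B).trans_lt ?_)
  exact ENNReal.mul_lt_top (ENNReal.rpow_lt_top_of_nonneg (by positivity) ENNReal.coe_ne_top) hB

/-- By compactness it suffices to argue locally, where `Φ.symm` is Lipschitz. In interior and
boundary charts alike, `M` goes into the hyperplane. -/
theorem IsC1Hypersurface.hausdorffMeasure_lt_top {d : ℕ} {M : Set (Vec (d + 1))}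
    (hMC : IsC1Hypersurface M) (hM : IsCompact M) : μH[(d : ℝ)] M < ⊤ := by
  refine hM.measure_lt_top_of_nhdsWithin fun x hx => ?_
  obtain ⟨Φ, hxΦ, -, hΦs, hΦM⟩ := hMC x hx
  have hyt : Φ x ∈ Φ.target := Φ.map_source hxΦ
  obtain ⟨K, t, ht, hK⟩ := (hΦs.contDiffAt (Φ.open_target.mem_nhds hyt)).exists_lipschitzOnWith
  obtain ⟨r, hr, hball⟩ := Metric.mem_nhds_iff.1 ht
  let H : Set (Vec (d + 1)) := {y | y (Fin.last d) = 0}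
  have hMH : ∀ z ∈ Φ.source, z ∈ M → Φ z ∈ H := fun z hz hzM => by
    rcases hΦM with h | h
    · exact (h hz).2 hzM
    · exact ((h hz).2 hzM).1
  refine ⟨Φ.symm '' (H ∩ Metric.ball (Φ x) r), ?_, ?_⟩
  · have hV : Φ.source ∩ Φ ⁻¹' Metric.ball (Φ x) r ∈ 𝓝 x :=
      inter_mem (Φ.open_source.mem_nhds hxΦ)
        ((Φ.continuousAt hxΦ).preimage_mem_nhds (Metric.ball_mem_nhds _ hr))
    filter_upwards [mem_nhdsWithin_of_mem_nhds hV, self_mem_nhdsWithin] with z hz hzM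
    exact ⟨Φ z, ⟨hMH z hz.1 hzM, hz.2⟩, Φ.left_inv hz.1⟩
  · refine ((hK.mono (inter_subset_right.trans hball)).hausdorffMeasure_image_le
      (by positivity)).trans_lt ?_
    exact ENNReal.mul_lt_top (ENNReal.rpow_lt_top_of_nonneg (by positivity) ENNReal.coe_ne_top)
      (hausdorffMeasure_hyperplane_inter_lt_top _ _)

theorem IsC1Hypersurface.isFiniteMeasure_surf {d : ℕ} {M : Set (Vec (d + 1))}
    (hMC : IsC1Hypersurface M) (hM : IsCompact M) : IsFiniteMeasure (surf M) := by
  refine ⟨?_⟩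
  rw [← (isometry_subtype_coe (s := M)).hausdorffMeasure_image (Or.inl (by positivity)),
    image_univ, Subtype.range_coe]
  exact hMC.hausdorffMeasure_lt_top hM

/-- Finite d-dimensional measure forces zero (d+1)-dimensional measure, and μH[d+1] is a Haar
measure. -/
theorem IsC1Hypersurface.volume_eq_zero {d : ℕ} {M : Set (Vec (d + 1))}
    (hMC : IsC1Hypersurface M) (hM : IsCompact M) : volume M = 0 := by
  have h0 : μH[((d + 1 : ℕ) : ℝ)] M = 0 :=
    (Measure.hausdorffMeasure_zero_or_top (show (d : ℝ) < ((d + 1 : ℕ) : ℝ) by simp) M).resolve_right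
      (hMC.hausdorffMeasure_lt_top hM).ne
  have : (μH[((d + 1 : ℕ) : ℝ)] : Measure (Vec (d + 1))).IsAddHaarMeasure := by
    have h := isAddHaarMeasure_hausdorffMeasure (E := Vec (d + 1))
    rwa [finrank_euclideanSpace_fin] at h
  exact Measure.absolutelyContinuous_isAddHaarMeasure volume _ h0

/-! ### Measurability of traces -/

section Trace

variable {n m : ℕ}

/-- The half ball of radius `r` around `x`, on the side to which `e` points, in `U`. -/
abbrev halfBall (U : Set (Vec n)) (e x : Vec n) (r : ℝ) : Set (Vec n) :=
  {y | y ∈ U ∧ y ∈ Metric.ball x r ∧ 0 < ⟪y - x, e⟫}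

theorem volume_halfBall_ne_top (U : Set (Vec n)) (e x : Vec n) (r : ℝ) :
    volume (halfBall U e x r) ≠ ⊤ :=
  measure_ne_top_of_subset (fun _ hy => hy.2.1) measure_ball_lt_top.ne

/-- Averages over null sets are 0 by convention, so without positivity every vector could be a
trace. Removing the null set `M` costs nothing, and the open half ball in `Ω` contains x + te for
small t > 0. -/
theorem volume_halfBall_diff_pos {Ω M : Set (Vec n)} (hΩ : IsOpen Ω) (hM : volume M = 0)
    {e x : Vec n} (hx : x ∈ Ω) (he : ‖e‖ = 1) {r : ℝ} (hr : 0 < r) :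
    0 < volume (halfBall (Ω \ M) e x r) := by
  have heq : halfBall (Ω \ M) e x r = halfBall Ω e x r \ M := by
    ext y
    exact ⟨fun h => ⟨⟨h.1.1, h.2⟩, h.1.2⟩, fun h => ⟨⟨h.1.1, h.2⟩, h.1.2⟩⟩
  rw [heq, measure_sdiff_null hM]
  have hopen : IsOpen (halfBall Ω e x r) :=
    hΩ.inter (Metric.isOpen_ball.inter (isOpen_lt (f := fun _ => (0 : ℝ))
      (g := fun y => ⟪y - x, e⟫) (by fun_prop) (by fun_prop)))
  refine hopen.measure_pos volume ?_
  obtain ⟨s, hs, hball⟩ := Metric.isOpen_iff.1 hΩ x hx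
  obtain ⟨t, ht, hts⟩ := exists_between (lt_min hs hr)
  have hdist : dist (x + t • e) x = t := by
    rw [dist_eq_norm, add_sub_cancel_left, norm_smul, he, mul_one, Real.norm_of_nonneg ht.le]
  refine ⟨x + t • e, hball ?_, ?_, ?_⟩
  · rw [Metric.mem_ball, hdist]; exact hts.trans_le (min_le_left _ _)
  · rw [Metric.mem_ball, hdist]; exact hts.trans_le (min_le_right _ _)
  · rw [add_sub_cancel_left, real_inner_smul_left, real_inner_self_eq_norm_sq, he]
    simpa using ht

variable {U : Set (Vec n)} {u : Vec n → Vec m}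

/-- The means over half balls converge to the trace. -/
theorem HasTraceAt.tendsto_average (hu : IntegrableOn u U) {e x : Vec n} {a : Vec m}
    (hpos : ∀ r, 0 < r → 0 < volume (halfBall U e x r)) (h : HasTraceAt U u e x a) :
    Tendsto (fun k : ℕ => ⨍ y in halfBall U e x (1 / ((k : ℝ) + 1)), u y) atTop (𝓝 a) := by
  have hr : Tendsto (fun k : ℕ => 1 / ((k : ℝ) + 1)) atTop (𝓝[>] 0) :=
    tendsto_nhdsWithin_iff.2 ⟨tendsto_one_div_add_atTop_nhds_zero_nat,
      Eventually.of_forall fun k => by rw [mem_Ioi]; positivity⟩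
  rw [tendsto_iff_edist_tendsto_0]
  refine tendsto_of_tendsto_of_tendsto_of_le_of_le tendsto_const_nhds (h.comp hr)
    (fun _ => zero_le) fun k => ?_
  have hk := hpos (1 / ((k : ℝ) + 1)) (by positivity)
  set H := halfBall U e x (1 / ((k : ℝ) + 1)) with hH
  have hfin := volume_halfBall_ne_top U e x (1 / ((k : ℝ) + 1))
  have huH : IntegrableOn u H := hu.mono_set fun y hy => hy.1
  have hca : IntegrableOn (fun _ => a) H := integrableOn_const hfin
  have hint : ∀ {f : Vec n → Vec m}, IntegrableOn f H →
      Integrable f ((volume.restrict H univ)⁻¹ • volume.restrict H) := fun hf =>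
    hf.smul_measure (by simpa using hk.ne')
  have hsub : (⨍ y in H, u y) - a = ⨍ y in H, (u y - a) := by
    nth_rewrite 1 [← setAverage_const hk.ne' hfin a]
    exact (integral_sub (hint huH) (hint hca)).symm
  rw [edist_eq_enorm_sub, hsub]
  exact enorm_integral_le_lintegral_enorm _

/-- The trace is the limit of the means, hence unique, so the choice in `traceAt` is harmless. -/
theorem HasTraceAt.traceAt_eq (hu : IntegrableOn u U) {e x : Vec n} {a : Vec m}
    (hpos : ∀ r, 0 < r → 0 < volume (halfBall U e x r)) (h : HasTraceAt U u e x a) :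
    traceAt U u e x = a := by
  have hex : ∃ a, HasTraceAt U u e x a := ⟨a, h⟩
  rw [traceAt, dif_pos hex]
  exact tendsto_nhds_unique (hex.choose_spec.tendsto_average hu hpos) (h.tendsto_average hu hpos)

theorem traceAt_eq_zero_of_ae_eq_zero (hu : u =ᵐ[volume.restrict U] 0)
    {e x : Vec n} (hpos : ∀ r, 0 < r → 0 < volume (halfBall U e x r)) :
    traceAt U u e x = 0 := by
  have hint : IntegrableOn u U := (integrable_zero _ _ _).congr hu.symm
  refine HasTraceAt.traceAt_eq hint hpos (tendsto_const_nhds.congr fun r => ?_)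
  have hsub : halfBall U e x r ⊆ U := fun y hy => hy.1
  have h0 : (fun y => ‖u y - 0‖ₑ) =ᵐ[volume.restrict (halfBall U e x r)] fun _ => 0 := by
    filter_upwards [ae_restrict_of_ae_restrict_of_subset hsub hu] with y hy
    simp [hy]
  rw [laverage_congr h0, laverage_zero]

/-- It is enough to test the existence of a trace on half balls with rational radii. -/
theorem hasTraceAt_iff_rat (e x : Vec n) (a : Vec m)
    (hpos : ∀ r, 0 < r → 0 < volume (halfBall U e x r)) :
    HasTraceAt U u e x a ↔ ∀ k : ℕ, ∃ j : ℕ, ∀ r : ℚ, 0 < r → (r : ℝ) < 1 / ((j : ℝ) + 1) →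
      ∫⁻ y in halfBall U e x r, ‖u y - a‖ₑ ≤
        ((k : ℝ≥0∞) + 1)⁻¹ * volume (halfBall U e x r) := by
  have hiff : ∀ {r : ℝ}, 0 < r → ∀ ε : ℝ≥0∞, ((⨍⁻ y in halfBall U e x r, ‖u y - a‖ₑ ∂volume) ≤ ε ↔
      ∫⁻ y in halfBall U e x r, ‖u y - a‖ₑ ≤ ε * volume (halfBall U e x r)) := fun {r} hr ε => by
    rw [setLAverage_eq, ENNReal.div_le_iff (hpos r hr).ne' (volume_halfBall_ne_top U e x r)]
  constructor
  · intro h k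
    have hk : (0 : ℝ≥0∞) < ((k : ℝ≥0∞) + 1)⁻¹ := by simp
    obtain ⟨δ, hδ, hδF⟩ := mem_nhdsGT_iff_exists_Ioo_subset.1
      (h.eventually (eventually_lt_nhds hk))
    obtain ⟨j, hj⟩ := exists_nat_one_div_lt (mem_Ioi.1 hδ)
    refine ⟨j, fun r hr hrj => (hiff (by exact_mod_cast hr) _).1 (hδF ⟨?_, hrj.trans hj⟩).le⟩
    exact_mod_cast hr
  · intro h
    refine ENNReal.tendsto_nhds_zero.2 fun ε hε => ?_
    obtain ⟨k, hk⟩ := ENNReal.exists_inv_nat_lt hε.ne'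
    obtain ⟨j, hj⟩ := h k
    have hIoo : Ioo (0 : ℝ) (1 / ((j : ℝ) + 1)) ∈ 𝓝[>] (0 : ℝ) :=
      Ioo_mem_nhdsGT (by positivity)
    filter_upwards [hIoo] with r hr
    refine le_trans ((hiff hr.1 _).2 ?_)
      ((ENNReal.inv_le_inv.2 (le_self_add (a := (k : ℝ≥0∞)) (b := 1))).trans hk.le)
    -- The half ball of radius r is the increasing union of those of rational radii below r.
    -- Multiplying out the average leaves two sides monotone in r, so the bound passes to the union.
    let Q := {q : ℚ // 0 < q ∧ (q : ℝ) < r}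
    have hunion : halfBall U e x r = ⋃ q : Q, halfBall U e x (q.1 : ℝ) := by
      ext y
      simp only [mem_iUnion]
      constructor
      · rintro ⟨hyU, hyr, hye⟩
        obtain ⟨q, hq1, hq2⟩ := exists_rat_btwn (max_lt (Metric.mem_ball.1 hyr) hr.1)
        exact ⟨⟨q, by exact_mod_cast (le_max_right _ _).trans_lt hq1, hq2⟩, hyU,
          Metric.mem_ball.2 ((le_max_left _ _).trans_lt hq1), hye⟩
      · rintro ⟨q, hyU, hyq, hye⟩
        exact ⟨hyU, Metric.ball_subset_ball q.2.2.le hyq, hye⟩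
    have hmono : Monotone fun q : Q => halfBall U e x (q.1 : ℝ) := fun q q' hqq y hy =>
      ⟨hy.1, Metric.ball_subset_ball (by exact_mod_cast hqq) hy.2.1, hy.2.2⟩
    conv_lhs => rw [hunion]
    rw [setLIntegral_iUnion_of_directed _ hmono.directed_le]
    refine iSup_le fun q => (hj q.1 q.2.1 (q.2.2.trans hr.2)).trans ?_
    gcongr
    exact fun y hy => ⟨hy.1, Metric.ball_subset_ball q.2.2.le hy.2.1, hy.2.2⟩

variable {X : Type*} [MeasurableSpace X] {e c : X → Vec n}

theorem measurableSet_setOf_mem_halfBall (hU : MeasurableSet U) (he : Measurable e)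
    (hc : Measurable c) (r : ℝ) :
    MeasurableSet {z : X × Vec n | z.2 ∈ halfBall U (e z.1) (c z.1) r} := by
  have hc' : Measurable fun z : X × Vec n => c z.1 := hc.comp measurable_fst
  have he' : Measurable fun z : X × Vec n => e z.1 := he.comp measurable_fst
  refine (measurable_snd hU).inter (MeasurableSet.inter ?_ ?_)
  · exact measurableSet_lt (measurable_snd.dist hc') measurable_const
  · exact measurableSet_lt measurable_const ((measurable_snd.sub hc').inner (𝕜 := ℝ) he')

theorem measurable_setLIntegral_halfBall (hU : MeasurableSet U) (he : Measurable e)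
    (hc : Measurable c) (r : ℝ) {f : X → Vec n → ℝ≥0∞} (hf : Measurable (Function.uncurry f)) :
    Measurable fun x => ∫⁻ y in halfBall U (e x) (c x) r, f x y := by
  have hS := measurableSet_setOf_mem_halfBall hU he hc r
  have h := (hf.indicator hS).lintegral_prod_right' (ν := volume)
  convert h using 2 with x
  exact (lintegral_indicator (measurable_prodMk_left (x := x) hS) (f x)).symm

theorem measurable_volume_halfBall (hU : MeasurableSet U) (he : Measurable e)
    (hc : Measurable c) (r : ℝ) : Measurable fun x => volume (halfBall U (e x) (c x) r) := by
  simpa using measurable_setLIntegral_halfBall hU he hc r (f := fun _ _ => 1) measurable_const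

theorem measurable_setAverage_halfBall (hU : MeasurableSet U) (he : Measurable e)
    (hc : Measurable c) (r : ℝ) (hu : StronglyMeasurable u) :
    Measurable fun x => ⨍ y in halfBall U (e x) (c x) r, u y := by
  have hS := measurableSet_setOf_mem_halfBall hU he hc r
  have h := ((hu.comp_measurable measurable_snd).indicator hS).integral_prod_right' (ν := volume)
  simp only [setAverage_eq]
  refine (measurable_volume_halfBall hU he hc r).ennreal_toReal.inv.smul ?_
  convert h.measurable using 2 with x
  exact (integral_indicator (f := u) (measurable_prodMk_left (x := x) hS)).symm

theorem measurableSet_setOf_hasTraceAt (hU : MeasurableSet U) (he : Measurable e)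
    (hc : Measurable c) (hu : Measurable u) {a : X → Vec m} (ha : Measurable a)
    (hpos : ∀ x r, 0 < r → 0 < volume (halfBall U (e x) (c x) r)) :
    MeasurableSet {x | HasTraceAt U u (e x) (c x) (a x)} := by
  simp only [fun x => hasTraceAt_iff_rat (u := u) (e x) (c x) (a x) (hpos x), ofPred_forall,
    ofPred_exists]
  refine MeasurableSet.iInter fun k => MeasurableSet.iUnion fun j => MeasurableSet.iInter fun r =>
    MeasurableSet.iInter fun _ => MeasurableSet.iInter fun _ => measurableSet_le ?_ ?_
  · refine measurable_setLIntegral_halfBall hU he hc r (f := fun x y => ‖u y - a x‖ₑ) ?_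
    exact ((hu.comp measurable_snd).sub (ha.comp measurable_fst)).enorm
  · exact (measurable_volume_halfBall hU he hc r).const_mul _

/-- The limit of the means is a measurable candidate for the trace. A trace exists exactly where
this candidate is one, a measurable set by the rational-radius criterion; elsewhere the value is 0.
-/
theorem measurable_traceAt (hU : MeasurableSet U) (he : Measurable e)
    (hc : Measurable c) (hu : StronglyMeasurable u) (hint : IntegrableOn u U)
    (hpos : ∀ x r, 0 < r → 0 < volume (halfBall U (e x) (c x) r)) :
    Measurable fun x => traceAt U u (e x) (c x) := by
  classical
  let b : ℕ → X → Vec m := fun k x => ⨍ y in halfBall U (e x) (c x) (1 / ((k : ℝ) + 1)), u y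
  have hb : ∀ k, Measurable (b k) := fun k => measurable_setAverage_halfBall hU he hc _ hu
  let L : Set X := {x | ∃ l, Tendsto (fun k => b k x) atTop (𝓝 l)}
  have hL : MeasurableSet L := measurableSet_exists_tendsto hb
  -- Setting the means to 0 where they diverge makes the sequence converge everywhere.
  have hlim : ∀ x, ∃ l, Tendsto (fun k => L.indicator (b k) x) atTop (𝓝 l) := fun x => by
    by_cases hx : x ∈ L
    · obtain ⟨l, hl⟩ := hx
      exact ⟨l, by simpa only [indicator_of_mem (show x ∈ L from ⟨l, hl⟩)] using hl⟩
    · exact ⟨0, by simp only [indicator_of_notMem hx, tendsto_const_nhds]⟩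
  choose a ha using hlim
  have ham : Measurable a := measurable_of_tendsto_metrizable
    (fun k => (hb k).indicator hL) (tendsto_pi_nhds.2 ha)
  let S : Set X := {x | HasTraceAt U u (e x) (c x) (a x)}
  have hS : MeasurableSet S := measurableSet_setOf_hasTraceAt hU he hc hu.measurable ham hpos
  have heq : (fun x => traceAt U u (e x) (c x)) = S.indicator a := by
    ext1 x
    by_cases hx : x ∈ S
    · rw [indicator_of_mem hx]
      exact HasTraceAt.traceAt_eq hint (hpos x) hx
    · rw [indicator_of_notMem hx, traceAt, dif_neg]
      rintro ⟨l, hl⟩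
      have hlb := hl.tendsto_average hint (hpos x)
      have hxL : x ∈ L := ⟨l, hlb⟩
      have hax := ha x
      simp only [indicator_of_mem hxL] at hax
      refine hx ?_
      change HasTraceAt U u (e x) (c x) (a x)
      rwa [tendsto_nhds_unique hax hlb]
  rw [heq]
  exact ham.indicator hS

end Trace

/-! ### Compactness for `σ^p_φ`-convergence -/

theorem measurable_jump {d m : ℕ} {Ω M : Set (Vec (d + 1))} {p : ℝ≥0∞} [Fact (1 ≤ p)]
    (hΩ : IsOpen Ω) (hΩb : Bornology.IsBounded Ω) (hM : IsCompact M) (hMΩ : M ⊆ Ω)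
    (hMC : IsC1Hypersurface M) {ν : Vec (d + 1) → Vec (d + 1)} (hν : IsOrientation M ν)
    (u : Sobolev m (Ω \ M) p) : Measurable (jump ν u) := by
  have hνm : Measurable fun x : M => ν x := (continuousOn_iff_continuous_domRestrict.1
    hν.continuousOn).measurable
  have hU : MeasurableSet (Ω \ M) := hΩ.measurableSet.diff hM.measurableSet
  have : IsFiniteMeasure (volume.restrict (Ω \ M)) :=
    ⟨by simpa using (hΩb.subset sdiff_subset).measure_lt_top⟩
  -- On a set of finite measure L^p is contained in L^1, as the means require.
  have hint : IntegrableOn u.1.1 (Ω \ M) := (Lp.memLp u.1.1).integrable Fact.out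
  have hsm := Lp.stronglyMeasurable u.1.1
  have hM0 := hMC.volume_eq_zero hM
  refine (measurable_traceAt hU hνm measurable_subtype_coe hsm hint fun x r hr => ?_).sub
    (measurable_traceAt hU hνm.neg measurable_subtype_coe hsm hint fun x r hr => ?_)
  · exact volume_halfBall_diff_pos hΩ hM0 (hMΩ x.2) (hν.norm_eq_one x x.2) hr
  · exact volume_halfBall_diff_pos hΩ hM0 (hMΩ x.2)
      ((norm_neg _).trans (hν.norm_eq_one x x.2)) hr

theorem jump_zero {d m : ℕ} {Ω M : Set (Vec (d + 1))} {p : ℝ≥0∞} [Fact (1 ≤ p)]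
    (hΩ : IsOpen Ω) (hM : IsCompact M) (hMΩ : M ⊆ Ω)
    (hMC : IsC1Hypersurface M) {ν : Vec (d + 1) → Vec (d + 1)} (hν : IsOrientation M ν) (x : M) :
    jump ν (0 : Sobolev m (Ω \ M) p) x = 0 := by
  have hM0 := hMC.volume_eq_zero hM
  have h0 : ((0 : Sobolev m (Ω \ M) p).1.1 : Vec (d + 1) → Vec m)
      =ᵐ[volume.restrict (Ω \ M)] 0 := Lp.coeFn_zero _ _ _
  rw [jump, traceAt_eq_zero_of_ae_eq_zero h0, traceAt_eq_zero_of_ae_eq_zero h0, sub_zero]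
  · exact fun r hr => volume_halfBall_diff_pos hΩ hM0 (hMΩ x.2)
      ((norm_neg _).trans (hν.norm_eq_one x x.2)) hr
  · exact fun r hr => volume_halfBall_diff_pos hΩ hM0 (hMΩ x.2) (hν.norm_eq_one x x.2) hr

end CohesiveCrack

end

theorem lemma4p5 {d m : ℕ} (hm : 1 ≤ m) (p : ℝ≥0∞) [Fact (1 ≤ p)] (hp1 : 1 < p) (hp : p ≠ ⊤)
    (Ω M : Set (CohesiveCrack.Vec (d + 1)))
    (hΩ : IsOpen Ω) (hΩb : Bornology.IsBounded Ω)
    (hM : IsCompact M) (hMΩ : M ⊆ Ω) (hMC : CohesiveCrack.IsC1Hypersurface M)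
    (hconn : IsConnected (Ω \ M))
    (ν : CohesiveCrack.Vec (d + 1) → CohesiveCrack.Vec (d + 1))
    (hν : CohesiveCrack.IsOrientation M ν)
    (φ : M × CohesiveCrack.Vec m → ℝ≥0∞) (hφ : CohesiveCrack.IsCrackDensity M φ)
    (γ : ℕ → CohesiveCrack.L0Plus M) :
    ∃ s : ℕ → ℕ, StrictMono s ∧ ∃ γlim : CohesiveCrack.L0Plus M,
      CohesiveCrack.SigmaTendsto Ω M p ν φ (fun k => γ (s k)) γlim := by
  have := hMC.isFiniteMeasure_surf hM
  have := CohesiveCrack.separableSpace_strongDual_Sobolev (m := m) hp1 hp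
    ((hΩb.subset (sdiff_subset (t := M))).measure_lt_top (μ := volume)).ne
  have hmeas : ∀ u : CohesiveCrack.Sobolev m (Ω \ M) p,
      Measurable (CohesiveCrack.crackEnergy φ ν u) := fun u =>
    hφ.measurable.comp
      (measurable_id.prodMk (CohesiveCrack.measurable_jump hΩ hΩb hM hMΩ hMC hν u))
  have hzero : ∀ k, CohesiveCrack.crackEnergy φ ν (0 : CohesiveCrack.Sobolev m (Ω \ M) p)
      ≤ᵐ[CohesiveCrack.surf M] γ k := fun k => by
    filter_upwards [hφ.zero] with x hx
    rw [CohesiveCrack.crackEnergy, CohesiveCrack.jump_zero hΩ hM hMΩ hMC hν, hx]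
    exact zero_le
  obtain ⟨s, hs, K, hK1, hK2⟩ := CohesiveCrack.exists_subseq_weak_kuratowski
    (fun k => {u : CohesiveCrack.Sobolev m (Ω \ M) p |
      CohesiveCrack.crackEnergy φ ν u ≤ᵐ[CohesiveCrack.surf M] γ k}) hzero
  -- The constant sequence 0 is admissible for every k, so its limit 0 lies in `K`.
  have hKne : Nonempty K := ⟨0, hK1 (fun _ => 0) 0 id (fun _ => tendsto_const_nhds) tendsto_id
    fun j => hzero _⟩
  -- An uncountable pointwise supremum over `K` need not be measurable; the countable subfamily
  -- gives a measurable γ and is itself the sequence u^i.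
  obtain ⟨c, hc⟩ := CohesiveCrack.exists_seq_ae_le_iSup (μ := CohesiveCrack.surf M)
    (fun u : K => CohesiveCrack.crackEnergy φ ν u.1) fun u => (hmeas u.1).aemeasurable
  have hsup : Measurable fun x => ⨆ i, CohesiveCrack.crackEnergy φ ν (c i).1 x :=
    Measurable.iSup fun i => hmeas (c i).1
  refine ⟨s, hs, AEEqFun.mk _ hsup.aestronglyMeasurable, ?_, ?_⟩
  · intro u v k huv hk hu
    exact (hc ⟨v, hK1 u v k huv hk hu⟩).trans (AEEqFun.coeFn_mk _ _).symm.le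
  · choose w hw1 hw2 using fun i => hK2 (c i).1 (c i).2
    exact ⟨fun i => (c i).1, (AEEqFun.coeFn_mk _ _).symm, w, hw1, hw2⟩
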